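/- Let $V$ be a finite-dimensional real vector space, and let $\mathcal{K}(V)$ be the set of convex bodies in $V$ (nonempty compact convex subsets of $V$), topologised by the Hausdorff metric coming from a norm on $V$ (the topology does not depend on the choice of norm). Let $A$ be a Hausdorff topological abelian group, and let $\varphi\colon\mathcal{K}(V)\to A$ be a continuous translation-invariant valuation; that is, $\varphi$ is continuous, $\varphi(v+K)=\varphi(K)$ for all $v\in V$ and $K\in\mathcal{K}(V)$, and \[ \varphi(B\cup C)=\varphi(B)+\varphi(C)-\varphi(B\cap C) \] whenever $B,C\in\mathcal{K}(V)$ and $B\cup C\in\mathcal{K}(V)$. Let $X\in\mathcal{K}(V)$ be a convex body of dimension $d$, i.e. the affine span of $X$ has dimension $d$. For $u\in[0,\infty)$ and $f\colon[0,\infty)\to A$ let $\Delta_u f\colon[0,\infty)\to A$ be the function $(\Delta_u f)(a)=f(a+u)-f(a)$. Then the function $f\colon[0,\infty)\to A$, $f(\lambda)=\varphi(\lambda X)$, satisfies \[ \Delta_{b_1}\cdots\Delta_{b_{d+1}}f=0\qquad\text{for all } b_1,\ldots,b_{d+1}\in[0,\infty). \] -/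

import Mathlib

open scoped NNReal Pointwise

namespace ConvexBody

variable {V : Type*} [NormedAddCommGroup V] [NormedSpace ℝ V]

/-- The translate `v + K` of a convex body `K`. -/
def translate (v : V) (K : ConvexBody V) : ConvexBody V where
  carrier := v +ᵥ (K : Set V)
  convex' := K.convex.vadd v
  isCompact' := K.isCompact.vadd v
  nonempty' := K.nonempty.vadd_set

/-- The dimension of a convex body: the dimension of its affine span. -/
noncomputable def dim (K : ConvexBody V) : ℕ :=
  Module.finrank ℝ (affineSpan ℝ (K : Set V)).direction

/-- `φ` is a valuation: `φ (B ∪ C) = φ B + φ C - φ (B ∩ C)` whenever `B`, `C` and `B ∪ C` are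
convex bodies. Here `U` is the convex body `B ∪ C` and `I` is the convex body `B ∩ C`; the
latter always exists when `U` does, by `exists_coe_eq_inter`. -/
def IsValuation {A : Type*} [AddCommGroup A] (φ : ConvexBody V → A) : Prop :=
  ∀ B C U I : ConvexBody V, (U : Set V) = (B : Set V) ∪ C → (I : Set V) = (B : Set V) ∩ C →
    φ U = φ B + φ C - φ I

/-- If the union of two convex bodies is a convex body, so is their intersection. -/
theorem exists_coe_eq_inter {B C U : ConvexBody V} (h : (U : Set V) = (B : Set V) ∪ C) :
    ∃ I : ConvexBody V, (I : Set V) = (B : Set V) ∩ C := by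
  have hne : ((B : Set V) ∩ C).Nonempty := by
    have hc := isPreconnected_closed_iff.1 U.convex.isPreconnected B C B.isClosed C.isClosed
      h.subset
    obtain ⟨b, hb⟩ := B.nonempty
    obtain ⟨c, hc'⟩ := C.nonempty
    obtain ⟨x, -, hx⟩ := hc ⟨b, h ▸ Or.inl hb, hb⟩ ⟨c, h ▸ Or.inr hc', hc'⟩
    exact ⟨x, hx⟩
  exact ⟨⟨_, B.convex.inter C.convex, B.isCompact.inter C.isCompact, hne⟩, rfl⟩

/-- `φ` is invariant under all translations of `V`. -/
def IsTranslationInvariant {A : Type*} (φ : ConvexBody V → A) : Prop :=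
  ∀ (v : V) (K : ConvexBody V), φ (K.translate v) = φ K

end ConvexBody

/-- The iterated difference `Δ_{b₁} ⋯ Δ_{bₙ} f` of `f : [0, ∞) → A`, where
`(Δ_u f) a = f (a + u) - f a`. -/
def iteratedDifference {A : Type*} [AddCommGroup A] {n : ℕ} (b : Fin n → ℝ≥0) (f : ℝ≥0 → A) :
    ℝ≥0 → A :=
  (List.ofFn b).foldr (fun u g => fwdDiff u g) f

namespace ConvexBody

/-! ### Hausdorff estimates and operations preserving valuations -/

section Basic

variable {V : Type*} [NormedAddCommGroup V] [NormedSpace ℝ V]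

/-! The proof is an induction on the number of differences, for all valuations `φ` at once
(`foldr_fwdDiff_smul_eq_zero`). With the differences and the evaluation point fixed, the result is a
continuous translation-invariant valuation `Ψ` of the body, and `Ψ` vanishes on bodies in smaller
subspaces by induction.

The main case is a pyramid `D` with apex `0` and base `Q` in `ℓ = 1`. Here `(t + b) • D` is the
union of `t • D` and `t • Q + b • D`, which meet in `t • Q`. So one difference of `φ (t • D)` equals
`φ' (t • Q)` with `φ' K = φ (K + b • D) - φ K`, again a continuous translation-invariant valuation.
As `Q` has smaller dimension, induction applies.

A polytope containing `0` is cut into such pyramids along hyperplanes through `0`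
(`IsValuation.eq_zero_of_isConeTruncation`); the overlaps lie in smaller subspaces. Polytopes
approximate any body, so continuity finishes. -/

theorem exists_mem_dist_le {K : ConvexBody V} (L : ConvexBody V) {x : V} (hx : x ∈ K) :
    ∃ y ∈ L, dist x y ≤ dist K L := by
  obtain ⟨y, hy, hxy⟩ := L.isCompact.exists_infDist_eq_dist L.nonempty x
  exact ⟨y, hy, hxy ▸ Metric.infDist_le_hausdorffDist_of_mem hx hausdorffEDist_ne_top⟩

theorem dist_le_of_forall_mem {K L : ConvexBody V} {r : ℝ} (hr : 0 ≤ r)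
    (hK : ∀ x ∈ K, ∃ y ∈ L, dist x y ≤ r) (hL : ∀ x ∈ L, ∃ y ∈ K, dist x y ≤ r) :
    dist K L ≤ r :=
  Metric.hausdorffDist_le_of_mem_dist hr hK hL

theorem lipschitzWith_of_forall_mem {F : ConvexBody V → ConvexBody V} (c : ℝ≥0)
    (h : ∀ K L, ∀ x ∈ F K, ∃ y ∈ F L, dist x y ≤ c * dist K L) : LipschitzWith c F :=
  LipschitzWith.of_dist_le_mul fun K L =>
    dist_le_of_forall_mem (by positivity) (h K L) (dist_comm K L ▸ h L K)

theorem continuous_add_right (E : ConvexBody V) : Continuous fun K : ConvexBody V => K + E := by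
  refine (lipschitzWith_of_forall_mem 1 fun K L x hx => ?_).continuous
  obtain ⟨k, hk, e, he, rfl⟩ := hx
  obtain ⟨l, hl, hkl⟩ := exists_mem_dist_le L hk
  exact ⟨l + e, Set.add_mem_add hl he, by simpa using hkl⟩

theorem continuous_smul_left (t : ℝ≥0) : Continuous fun K : ConvexBody V => t • K := by
  refine (lipschitzWith_of_forall_mem t fun K L x hx => ?_).continuous
  obtain ⟨k, hk, rfl⟩ := hx
  obtain ⟨l, hl, hkl⟩ := exists_mem_dist_le L hk
  refine ⟨t • l, Set.smul_mem_smul_set hl, ?_⟩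
  change dist (t • k) (t • l) ≤ _
  rw [NNReal.smul_def, NNReal.smul_def, dist_smul₀, Real.norm_of_nonneg t.coe_nonneg]
  gcongr

/-- The intersection of a convex body with a closed convex set meeting it. -/
def interOfMem (K : ConvexBody V) (s : Set V) (hs : Convex ℝ s) (hs' : IsClosed s)
    (h : ((K : Set V) ∩ s).Nonempty) : ConvexBody V :=
  ⟨K ∩ s, K.convex.inter hs, K.isCompact.inter_right hs', h⟩

@[simp]
theorem coe_interOfMem (K : ConvexBody V) (s : Set V) (hs : Convex ℝ s) (hs' : IsClosed s)
    (h : ((K : Set V) ∩ s).Nonempty) : (K.interOfMem s hs hs' h : Set V) = (K : Set V) ∩ s :=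
  rfl

theorem translate_add (v : V) (K E : ConvexBody V) :
    (K + E).translate v = K.translate v + E := by
  ext x
  simp [translate, vadd_add_assoc]

theorem smul_translate (t : ℝ≥0) (v : V) (K : ConvexBody V) :
    t • K.translate v = (t • K).translate (t • v) := by
  ext1
  change t • (v +ᵥ (K : Set V)) = (t • v) +ᵥ (t • (K : Set V))
  simp only [← Set.image_vadd, ← Set.image_smul, Set.image_image, vadd_eq_add, smul_add]

theorem exists_mem_segment_mem_inter {B C U : ConvexBody V} (hU : (U : Set V) = (B : Set V) ∪ C)
    {b c : V} (hb : b ∈ B) (hc : c ∈ C) : ∃ p ∈ segment ℝ b c, p ∈ B ∧ p ∈ C := by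
  have hbU : b ∈ (U : Set V) := hU ▸ Or.inl hb
  have hcU : c ∈ (U : Set V) := hU ▸ Or.inr hc
  obtain ⟨p, hp, hp'⟩ := isPreconnected_closed_iff.1 (convex_segment (𝕜 := ℝ) b c).isPreconnected
    B C B.isClosed C.isClosed ((U.convex.segment_subset hbU hcU).trans hU.subset)
    ⟨b, left_mem_segment ℝ b c, hb⟩ ⟨c, right_mem_segment ℝ b c, hc⟩
  exact ⟨p, hp, hp'⟩

theorem IsTranslationInvariant.comp_add_right {A : Type*} {φ : ConvexBody V → A}
    (hφ : IsTranslationInvariant φ) (E : ConvexBody V) :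
    IsTranslationInvariant fun K => φ (K + E) := fun v K => by
  simp only [← translate_add, hφ v]

/-- The dilates of a single point are translates of each other. -/
theorem IsTranslationInvariant.smul_eq_of_subsingleton {A : Type*} {φ : ConvexBody V → A}
    (hφ : IsTranslationInvariant φ) {X : ConvexBody V}
    (hX : (X : Set V).Subsingleton) (t : ℝ≥0) : φ (t • X) = φ 0 := by
  obtain ⟨x, hx⟩ := X.nonempty
  have hX' := hX.eq_singleton_of_mem hx
  rw [← hφ (t • x) 0]
  congr 1
  ext1
  change t • (X : Set V) = t • x +ᵥ ({0} : Set V)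
  simp [hX']

variable {A : Type*} [AddCommGroup A] {φ ψ : ConvexBody V → A}

theorem IsValuation.sub (hφ : IsValuation φ) (hψ : IsValuation ψ) : IsValuation (φ - ψ) := by
  intro B C U I hU hI
  simp only [Pi.sub_apply, hφ B C U I hU hI, hψ B C U I hU hI]
  abel

theorem IsValuation.comp_smul (hφ : IsValuation φ) (t : ℝ≥0) :
    IsValuation fun K => φ (t • K) := by
  intro B C U I hU hI
  obtain rfl | ht := eq_or_ne t 0
  · simp
  · refine hφ _ _ _ _ ?_ ?_
    · simp [hU, Set.smul_set_union]
    · simp [hI, Set.smul_set_inter₀ ht]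

/-- If `b + e = c + e'`, a point of the segment from `b` to `c` lies in both bodies; the same convex
combination of `e` and `e'` completes it to the given sum. -/
theorem IsValuation.comp_add_right (hφ : IsValuation φ) (E : ConvexBody V) :
    IsValuation fun K => φ (K + E) := by
  intro B C U I hU hI
  refine hφ _ _ _ _ ?_ ?_
  · simp [hU, Set.union_add]
  · simp only [coe_add, hI]
    refine Set.Subset.antisymm Set.inter_add_subset ?_
    rintro x ⟨⟨b, hb, e, he, rfl⟩, ⟨c, hc, e', he', hx⟩⟩
    obtain ⟨p, ⟨s, t, hs, ht, hst, rfl⟩, hpB, hpC⟩ := exists_mem_segment_mem_inter hU hb hc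
    refine ⟨_, ⟨hpB, hpC⟩, s • e + t • e', E.convex he he' hs ht hst, ?_⟩
    change c + e' = b + e at hx
    calc s • b + t • c + (s • e + t • e') = s • (b + e) + t • (c + e') := by module
      _ = b + e := by rw [hx, ← add_smul, hst, one_smul]

theorem IsTranslationInvariant.sub (hφ : IsTranslationInvariant φ)
    (hψ : IsTranslationInvariant ψ) : IsTranslationInvariant (φ - ψ) := fun v K => by
  simp [hφ v K, hψ v K]

theorem isValuation_foldr_fwdDiff {F : ConvexBody V → ℝ≥0 → A}
    (hF : ∀ t, IsValuation fun K => F K t) (L : List ℝ≥0) (t : ℝ≥0) :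
    IsValuation fun K => L.foldr (fun u g => fwdDiff u g) (F K) t := by
  induction L generalizing t with
  | nil => exact hF t
  | cons u L ih => exact (ih (t + u)).sub (ih t)

theorem continuous_foldr_fwdDiff [TopologicalSpace A] [IsTopologicalAddGroup A]
    {F : ConvexBody V → ℝ≥0 → A} (hF : ∀ t, Continuous fun K => F K t) (L : List ℝ≥0) (t : ℝ≥0) :
    Continuous fun K => L.foldr (fun u g => fwdDiff u g) (F K) t := by
  induction L generalizing t with
  | nil => exact hF t
  | cons u L ih => exact (ih (t + u)).sub (ih t)

-- Truncated cones and the decomposition of dilated pyramids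

end Basic

section Truncation

variable {V : Type*} [NormedAddCommGroup V] [NormedSpace ℝ V]

/-- `D` is the intersection of a convex cone with the half-spaces `ℓ ≤ 1` for `ℓ ∈ s`. -/
structure IsConeTruncation (s : List (V →L[ℝ] ℝ)) (D : ConvexBody V) : Prop where
  zero_mem : 0 ∈ D
  le_one : ∀ x ∈ D, ∀ ℓ ∈ s, ℓ x ≤ 1
  smul_mem : ∀ x ∈ D, ∀ t : ℝ, 0 ≤ t → (∀ ℓ ∈ s, ℓ (t • x) ≤ 1) → t • x ∈ D

/-- Where `ℓ' ≤ ℓ`, the bound on `ℓ` implies the one on `ℓ'`, so `ℓ'` can be dropped from the list.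
-/
theorem IsConeTruncation.inter_le {ℓ ℓ' : V →L[ℝ] ℝ} {s s' : List (V →L[ℝ] ℝ)}
    {D E : ConvexBody V} (hD : IsConeTruncation s D) (hs : ∀ m ∈ s, m = ℓ' ∨ m ∈ s')
    (hs' : ∀ m ∈ s', m ∈ s) (hℓ : ℓ ∈ s')
    (hE : (E : Set V) = (D : Set V) ∩ {x | ℓ' x ≤ ℓ x}) : IsConeTruncation s' E := by
  have hE' : ∀ x, x ∈ E ↔ x ∈ D ∧ ℓ' x ≤ ℓ x := fun x => by
    rw [← SetLike.mem_coe, hE]; rfl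
  refine ⟨(hE' 0).2 ⟨hD.zero_mem, by simp⟩, fun x hx m hm =>
    hD.le_one x ((hE' x).1 hx).1 m (hs' m hm), fun x hx t ht h => ?_⟩
  obtain ⟨hxD, hx'⟩ := (hE' x).1 hx
  have h' : ℓ' (t • x) ≤ ℓ (t • x) := by
    simpa using mul_le_mul_of_nonneg_left hx' ht
  refine (hE' _).2 ⟨hD.smul_mem x hxD t ht fun m hm => ?_, h'⟩
  rcases hs m hm with rfl | hm
  exacts [h'.trans (h ℓ hℓ), h m hm]

/-- A valuation vanishes on a truncated cone in `W` if it vanishes on convex bodies of smaller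
dimension and on cones truncated by a single half-space. -/
theorem IsValuation.eq_zero_of_isConeTruncation [FiniteDimensional ℝ V] {A : Type*}
    [AddCommGroup A] {ψ : ConvexBody V → A} (hψ : IsValuation ψ) {W : Submodule ℝ V}
    (hlow : ∀ W' : Submodule ℝ V, W' < W → ∀ K : ConvexBody V, (K : Set V) ⊆ W' → ψ K = 0)
    (hpyr : ∀ (ℓ : V →L[ℝ] ℝ) (D : ConvexBody V), (D : Set V) ⊆ W →
      IsConeTruncation [ℓ] D → ψ D = 0)
    (s : List (V →L[ℝ] ℝ)) (ℓ : V →L[ℝ] ℝ) (D : ConvexBody V) (hDW : (D : Set V) ⊆ W)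
    (hD : IsConeTruncation (ℓ :: s) D) : ψ D = 0 := by
  induction s generalizing ℓ D with
  | nil => exact hpyr ℓ D hDW hD
  | cons ℓ' s ih =>
    have key : ∀ f g : V →L[ℝ] ℝ, Convex ℝ {x | f x ≤ g x} ∧ IsClosed {x | f x ≤ g x} := by
      intro f g
      refine ⟨?_, isClosed_le f.continuous g.continuous⟩
      have := convex_halfSpace_le (f - g).isLinear 0
      simpa using this
    have h0 : ∀ f g : V →L[ℝ] ℝ, ((D : Set V) ∩ {x | f x ≤ g x}).Nonempty := fun f g =>
      ⟨0, hD.zero_mem, by simp⟩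
    set D₁ := D.interOfMem {x | ℓ' x ≤ ℓ x} (key _ _).1 (key _ _).2 (h0 _ _) with hD₁
    set D₂ := D.interOfMem {x | ℓ x ≤ ℓ' x} (key _ _).1 (key _ _).2 (h0 _ _) with hD₂
    have h₁ : ψ D₁ = 0 := by
      refine ih ℓ D₁ (Set.inter_subset_left.trans hDW)
        (hD.inter_le (ℓ := ℓ) (ℓ' := ℓ') ?_ ?_ (by simp) rfl) <;> simp <;> tauto
    have h₂ : ψ D₂ = 0 := by
      refine ih ℓ' D₂ (Set.inter_subset_left.trans hDW)
        (hD.inter_le (ℓ := ℓ') (ℓ' := ℓ) ?_ ?_ ?_ rfl) <;> simp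
      tauto
    -- If the functionals agree on `W`, the cut is trivial and its hyperplane yields no smaller
    -- subspace.
    by_cases hW : ∀ x ∈ W, ℓ x = ℓ' x
    · have : D₁ = D := by
        ext1
        exact Set.inter_eq_left.2 fun x hx => (hW x (hDW hx)).ge
      rwa [← this]
    · have hU : (D : Set V) = (D₁ : Set V) ∪ D₂ := by
        ext x
        have := le_total (ℓ x) (ℓ' x)
        simp only [hD₁, hD₂, coe_interOfMem, Set.mem_union, Set.mem_inter_iff, Set.mem_ofPred_eq]
        tauto
      obtain ⟨I, hI⟩ := exists_coe_eq_inter hU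
      rw [hψ D₁ D₂ D I hU hI, h₁, h₂, hlow (W ⊓ (ℓ - ℓ').ker) ?_ I ?_]
      · simp
      · refine inf_le_left.lt_of_ne fun h => hW fun x hx => ?_
        have : x ∈ (ℓ - ℓ').ker := (inf_eq_left.1 h) hx
        simpa [sub_eq_zero] using this
      · rw [hI]
        rintro x ⟨⟨hx, hx₁⟩, -, hx₂⟩
        refine ⟨hDW hx, ?_⟩
        simpa [sub_eq_zero] using le_antisymm hx₂ hx₁

variable {ℓ : V →L[ℝ] ℝ} {D Q : ConvexBody V}

/-- Otherwise the whole ray through `x` would satisfy the constraint and lie in the bounded set `D`.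
-/
theorem IsConeTruncation.eq_zero_of_nonpos (hD : IsConeTruncation [ℓ] D) {x : V} (hx : x ∈ D)
    (h : ℓ x ≤ 0) : x = 0 := by
  by_contra hx0
  obtain ⟨C, hC, hDC⟩ := D.isBounded.exists_pos_norm_le
  have hx' : 0 < ‖x‖ := norm_pos_iff.2 hx0
  have h1 := hDC _ (hD.smul_mem x hx ((C + 1) / ‖x‖) (by positivity) (by
    have : (C + 1) / ‖x‖ * ℓ x ≤ 0 := mul_nonpos_of_nonneg_of_nonpos (by positivity) h
    simp only [List.mem_singleton, forall_eq, map_smul, smul_eq_mul]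
    linarith))
  rw [norm_smul, Real.norm_of_nonneg (by positivity), div_mul_cancel₀ _ hx'.ne'] at h1
  linarith

theorem IsConeTruncation.nonneg (hD : IsConeTruncation [ℓ] D) {x : V} (hx : x ∈ D) :
    0 ≤ ℓ x := by
  by_contra! h
  simp [hD.eq_zero_of_nonpos hx h.le] at h

theorem IsConeTruncation.inv_smul_mem (hD : IsConeTruncation [ℓ] D) {x : V} (hx : x ∈ D)
    (h : 0 < ℓ x) : (ℓ x)⁻¹ • x ∈ (D : Set V) ∩ {x | ℓ x = 1} := by
  have h1 : ℓ ((ℓ x)⁻¹ • x) = 1 := by simp [h.ne']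
  exact ⟨hD.smul_mem x hx _ (by positivity) (by simp [h.ne']), h1⟩

theorem IsConeTruncation.coe_add_smul (hD : IsConeTruncation [ℓ] D)
    (hQ : (Q : Set V) = (D : Set V) ∩ {x | ℓ x = 1}) (t b : ℝ≥0) :
    (((t + b) • D : ConvexBody V) : Set V) =
      ((t • D : ConvexBody V) : Set V) ∪ (t • Q + b • D : ConvexBody V) := by
  have hQD : Q ≤ D := by
    rw [← SetLike.coe_subset_coe, hQ]; exact Set.inter_subset_left
  refine Set.Subset.antisymm ?_ (Set.union_subset ?_ ?_)
  · rintro _ ⟨x, hx, rfl⟩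
    change (t + b) • x ∈ _
    by_cases h : (t + b) * ℓ x ≤ t
    · left
      obtain rfl | ht := eq_or_ne t 0
      · have h0 : ((0 : ℝ≥0) + b) • x = 0 := by
          obtain rfl | hb := eq_or_ne b 0
          · simp
          · rw [hD.eq_zero_of_nonpos hx, smul_zero]
            have : (0 : ℝ) < b := by positivity
            simp only [NNReal.coe_zero, zero_add] at h
            by_contra! h'
            have := mul_pos this h'
            linarith
        rw [h0]
        exact ⟨0, hD.zero_mem, by simp⟩
      · have ht' : (0 : ℝ) < t := by positivity
        refine ⟨((t + b) / t : ℝ) • x, hD.smul_mem x hx _ (by positivity) ?_, ?_⟩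
        · simp only [List.mem_singleton, forall_eq, map_smul, smul_eq_mul]
          rw [div_mul_eq_mul_div, div_le_one ht']
          exact h
        · change (t : ℝ) • ((t + b) / t : ℝ) • x = ((t + b : ℝ≥0) : ℝ) • x
          rw [smul_smul]
          congr 1
          push_cast
          field_simp
    · right
      push Not at h
      have hx1 : ℓ x ≤ 1 := hD.le_one x hx ℓ (by simp)
      have hxp : 0 < ℓ x := by
        refine (hD.nonneg hx).lt_of_ne fun h' => ?_
        rw [← h', mul_zero] at h
        exact absurd h (not_lt.2 t.coe_nonneg)
      obtain ⟨q, hq, hxq⟩ : ∃ q ∈ (D : Set V) ∩ {x | ℓ x = 1}, x = ℓ x • q :=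
        ⟨_, hD.inv_smul_mem hx hxp, by simp [smul_smul, hxp.ne']⟩
      -- The excess height over `t • Q`: the point is `t • q + r • q` with `0 < r ≤ b`.
      set r : ℝ := (t + b) * ℓ x - t with hr
      have hr0 : 0 < r := by linarith
      have hrb : r ≤ b := by
        have : (t + b : ℝ) * ℓ x ≤ t + b := mul_le_of_le_one_right (by positivity) hx1
        linarith
      have hb : (0 : ℝ) < b := hr0.trans_le hrb
      refine ⟨t • q, ⟨q, hQ ▸ hq, rfl⟩, b • (r / b) • q,
        ⟨_, D.convex.smul_mem_of_zero_mem hD.zero_mem hq.1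
          ⟨by positivity, (div_le_one hb).2 hrb⟩, rfl⟩, ?_⟩
      change (t : ℝ) • q + (b : ℝ) • (r / b) • q = ((t + b : ℝ≥0) : ℝ) • x
      conv_rhs => rw [hxq]
      rw [smul_smul, smul_smul, ← add_smul, mul_div_cancel₀ _ hb.ne', hr]
      congr 1
      push_cast
      ring
  · exact smul_le_of_le D hD.zero_mem le_self_add
  · rw [add_smul, coe_add, coe_add]
    exact Set.add_subset_add_right (Set.smul_set_mono hQD)

theorem IsConeTruncation.coe_smul_eq_inter (hD : IsConeTruncation [ℓ] D)
    (hQ : (Q : Set V) = (D : Set V) ∩ {x | ℓ x = 1}) (t b : ℝ≥0) :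
    ((t • Q : ConvexBody V) : Set V) =
      ((t • D : ConvexBody V) : Set V) ∩ (t • Q + b • D : ConvexBody V) := by
  have hQ' : ∀ x ∈ Q, x ∈ D ∧ ℓ x = 1 := fun x hx => by
    rw [← SetLike.mem_coe, hQ] at hx; exact hx
  refine Set.Subset.antisymm ?_ ?_
  · rintro _ ⟨q, hq, rfl⟩
    refine ⟨⟨q, (hQ' q hq).1, rfl⟩, t • q, ⟨q, hq, rfl⟩, 0, ⟨0, hD.zero_mem, by simp⟩, ?_⟩
    exact add_zero _
  · rintro _ ⟨⟨x, hx, rfl⟩, _, ⟨q, hq, rfl⟩, _, ⟨y, hy, rfl⟩, h⟩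
    change (t : ℝ) • q + (b : ℝ) • y = (t : ℝ) • x at h
    change (t : ℝ) • x ∈ _
    suffices hby : (b : ℝ) • y = 0 by
      rw [← h, hby, add_zero]
      exact ⟨q, hq, rfl⟩
    -- Comparing heights, `t + b * ℓ y = t * ℓ x ≤ t` forces `b * ℓ y ≤ 0`.
    have h1 := congrArg ℓ h
    simp only [map_add, map_smul, smul_eq_mul, (hQ' q hq).2] at h1
    have hx1 : (t : ℝ) * ℓ x ≤ t :=
      mul_le_of_le_one_right t.coe_nonneg (hD.le_one x hx ℓ (by simp))
    obtain hb | hb := b.coe_nonneg.eq_or_lt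
    · simp [← hb]
    · rw [hD.eq_zero_of_nonpos hy, smul_zero]
      by_contra! hy'
      have := mul_pos hb hy'
      linarith

end Truncation

/-! ### Outer approximation by polytopes -/

section Approximation

variable {V : Type*} [NormedAddCommGroup V] [NormedSpace ℝ V]

theorem exists_le_one_lt {K : ConvexBody V} (h0 : 0 ∈ K) {x : V} (hx : x ∉ K) :
    ∃ ℓ : V →L[ℝ] ℝ, (∀ y ∈ K, ℓ y ≤ 1) ∧ 1 < ℓ x := by
  obtain ⟨f, u, hf, hu⟩ := geometric_hahn_banach_closed_point K.convex K.isClosed hx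
  have hu0 : 0 < u := by simpa using hf 0 h0
  refine ⟨u⁻¹ • f, fun y hy => ?_, ?_⟩
  · simpa [inv_mul_le_one₀ hu0] using (hf y hy).le
  · simpa [one_lt_inv_mul₀ hu0] using hu

/-- A convex body containing `0` is approximated from outside, within any subspace containing
it, by a polytope. -/
theorem exists_polytope_dist_le [FiniteDimensional ℝ V] {K : ConvexBody V} (h0 : 0 ∈ K)
    {W : Submodule ℝ V} (hW : (K : Set V) ⊆ W) {ε : ℝ} (hε : 0 < ε) :
    ∃ (s : List (V →L[ℝ] ℝ)) (P : ConvexBody V),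
      (P : Set V) = {x | x ∈ W ∧ ∀ ℓ ∈ s, ℓ x ≤ 1} ∧ dist K P ≤ ε := by
  have := FiniteDimensional.proper ℝ V
  have hthick : ∀ x, Metric.infDist x (K : Set V) ≤ ε → x ∈ Metric.cthickening ε (K : Set V) := by
    intro x hx
    obtain ⟨y, hy, hxy⟩ := K.isCompact.exists_infDist_eq_dist K.nonempty x
    exact Metric.mem_cthickening_of_dist_le x y ε _ hy (hxy ▸ hx)
  -- Finitely many half-spaces exclude this compact shell. Their intersection with `W` is connected
  -- and contains `0`, so it cannot reach beyond the shell.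
  set S : Set V := {x | Metric.infDist x K = ε} with hS
  have hSc : IsCompact S := by
    refine K.isCompact.cthickening (r := ε) |>.of_isClosed_subset
      (isClosed_eq (Metric.continuous_infDist_pt _) continuous_const) fun x hx => ?_
    exact hthick x (le_of_eq hx)
  have hSK : ∀ x ∈ S, x ∉ K := fun x hx hxK => by
    have : Metric.infDist x (K : Set V) = ε := hx
    rw [Metric.infDist_zero_of_mem hxK] at this
    exact hε.ne this
  choose! f hf hf' using fun x (hx : x ∈ S) => exists_le_one_lt h0 (hSK x hx)
  obtain ⟨T, hTS, hT⟩ := hSc.elim_nhds_subcover (fun x => {y | 1 < f x y}) fun x hx =>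
    (isOpen_lt continuous_const (f x).continuous).mem_nhds (hf' x hx)
  set P : Set V := {x | x ∈ W ∧ ∀ ℓ ∈ T.toList.map f, ℓ x ≤ 1} with hP
  have hPc : Convex ℝ P := by
    intro x hx y hy a b ha hb hab
    refine ⟨W.add_mem (W.smul_mem _ hx.1) (W.smul_mem _ hy.1), fun ℓ hℓ => ?_⟩
    simp only [map_add, map_smul, smul_eq_mul]
    have h1 := mul_le_mul_of_nonneg_left (hx.2 ℓ hℓ) ha
    have h2 := mul_le_mul_of_nonneg_left (hy.2 ℓ hℓ) hb
    linarith
  have hKP : (K : Set V) ⊆ P := fun x hx => by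
    refine ⟨hW hx, fun ℓ hℓ => ?_⟩
    obtain ⟨z, hz, rfl⟩ := List.mem_map.1 hℓ
    exact hf z (hTS z (Finset.mem_toList.1 hz)) x hx
  have hPcl : IsClosed P := by
    have : P = (W : Set V) ∩ ⋂ ℓ ∈ T.toList.map f, {x | ℓ x ≤ 1} := by
      ext x; simp [hP]
    rw [this]
    exact W.closed_of_finiteDimensional.inter
      (isClosed_biInter fun ℓ _ => isClosed_le ℓ.continuous continuous_const)
  have hPε : ∀ x ∈ P, Metric.infDist x K ≤ ε := by
    intro x hx
    by_contra! h
    obtain ⟨y, hy, hyε⟩ := hPc.isPreconnected.intermediate_value (hKP h0) hx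
      (Metric.continuous_infDist_pt (K : Set V)).continuousOn
      ⟨(Metric.infDist_zero_of_mem (s := (K : Set V)) h0).trans_le hε.le, h.le⟩
    obtain ⟨z, hz, hyz⟩ := Set.mem_iUnion₂.1 (hT hyε)
    exact absurd (hy.2 (f z) (List.mem_map_of_mem (Finset.mem_toList.2 hz))) (not_le.2 hyz)
  have hPcomp : IsCompact P := K.isCompact.cthickening (r := ε) |>.of_isClosed_subset hPcl
    fun x hx => hthick x (hPε x hx)
  refine ⟨T.toList.map f, ⟨P, hPc, hPcomp, ⟨0, hKP h0⟩⟩, rfl, ?_⟩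
  refine dist_le_of_forall_mem hε.le (fun x hx => ⟨x, hKP hx, by simp [hε.le]⟩) fun x hx => ?_
  obtain ⟨y, hy, hxy⟩ := K.isCompact.exists_infDist_eq_dist K.nonempty x
  exact ⟨y, hy, hxy ▸ hPε x hx⟩

end Approximation

/-! ### The induction on the number of differences -/

section Polynomiality

variable {V : Type*} [NormedAddCommGroup V] [NormedSpace ℝ V] {A : Type*} [AddCommGroup A]
  {φ : ConvexBody V → A}

theorem foldr_fwdDiff_zero (L : List ℝ≥0) :
    L.foldr (fun u g => fwdDiff u g) (0 : ℝ≥0 → A) = 0 := by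
  induction L with
  | nil => rfl
  | cons u L ih => rw [List.foldr_cons, ih]; ext; simp [fwdDiff]

/-- The difference of the dilates of a pyramid is governed by the dilates of its base. -/
theorem IsConeTruncation.fwdDiff_eq (hval : IsValuation φ) {ℓ : V →L[ℝ] ℝ} {D Q : ConvexBody V}
    (hD : IsConeTruncation [ℓ] D) (hQ : (Q : Set V) = (D : Set V) ∩ {x | ℓ x = 1}) (b : ℝ≥0) :
    fwdDiff b (fun t : ℝ≥0 => φ (t • D)) =
      fun t => ((fun K => φ (K + b • D)) - φ) (t • Q) := by
  ext t
  simp only [fwdDiff, Pi.sub_apply]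
  rw [hval _ _ _ _ (hD.coe_add_smul hQ t b) (hD.coe_smul_eq_inter hQ t b)]
  abel

theorem foldr_fwdDiff_smul_eq_zero [FiniteDimensional ℝ V] [TopologicalSpace A]
    [IsTopologicalAddGroup A] [T2Space A] (hcont : Continuous φ) (hval : IsValuation φ)
    (htrans : IsTranslationInvariant φ) (L : List ℝ≥0) (W : Submodule ℝ V)
    (hL : Module.finrank ℝ W < L.length) (X : ConvexBody V) (hX : ∀ x ∈ X, ∀ y ∈ X, x - y ∈ W) :
    L.foldr (fun u g => fwdDiff u g) (fun t => φ (t • X)) = 0 := by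
  induction hn : L.length generalizing φ L W X with
  | zero => omega
  | succ n ih =>
    ext a
    set Ψ : ConvexBody V → A := fun K =>
      L.foldr (fun u g => fwdDiff u g) (fun t => φ (t • K)) a with hΨ
    have hΨcont : Continuous Ψ :=
      continuous_foldr_fwdDiff (fun t => hcont.comp (continuous_smul_left t)) L a
    have hΨval : IsValuation Ψ := isValuation_foldr_fwdDiff (fun t => hval.comp_smul t) L a
    have hlow : ∀ W' : Submodule ℝ V, W' < W → ∀ K : ConvexBody V, (K : Set V) ⊆ W' →
        Ψ K = 0 := by
      intro W' hW' K hK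
      obtain ⟨u, L', rfl⟩ := List.exists_cons_of_length_eq_add_one hn
      have hlt := Submodule.finrank_lt_finrank_of_lt hW'
      simp only [List.length_cons] at hn hL
      have := ih hcont hval htrans L' W' (by omega) K
        (fun x hx y hy => W'.sub_mem (hK hx) (hK hy)) (by omega)
      simp [hΨ, this, fwdDiff]
    -- The last entry is the innermost difference, the one acting directly on `φ (t • D)`.
    obtain ⟨L', b, rfl⟩ : ∃ L' b, L = L' ++ [b] :=
      ⟨_, _, (List.dropLast_concat_getLast (by rintro rfl; simp at hn)).symm⟩
    have hpyr : ∀ (ℓ : V →L[ℝ] ℝ) (D : ConvexBody V), (D : Set V) ⊆ W →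
        IsConeTruncation [ℓ] D → Ψ D = 0 := by
      intro ℓ D hDW hD
      simp only [List.length_append, List.length_singleton] at hn hL
      simp only [hΨ, List.foldr_append, List.foldr_cons, List.foldr_nil]
      by_cases hne : ((D : Set V) ∩ {x | ℓ x = 1}).Nonempty
      · set Q := D.interOfMem {x | ℓ x = 1} (convex_hyperplane ℓ.isLinear 1)
          (isClosed_eq ℓ.continuous continuous_const) hne
        have hlt : W ⊓ ℓ.ker < W := by
          refine inf_le_left.lt_of_ne fun h => ?_
          obtain ⟨x, hx, hx1⟩ := hne
          have : x ∈ ℓ.ker := (inf_eq_left.1 h) (hDW hx)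
          have h0 : ℓ x = 0 := this
          exact zero_ne_one (h0.symm.trans hx1)
        have hlt' := Submodule.finrank_lt_finrank_of_lt hlt
        rw [hD.fwdDiff_eq hval (Q := Q) rfl b, ih (φ := (fun K => φ (K + b • D)) - φ)
          ((hcont.comp (continuous_add_right (b • D))).sub hcont)
          ((hval.comp_add_right _).sub hval) ((htrans.comp_add_right _).sub htrans) L'
          (W ⊓ ℓ.ker) (by omega) Q ?_ (by omega), Pi.zero_apply]
        rintro x ⟨hx, hx1⟩ y ⟨hy, hy1⟩
        refine ⟨W.sub_mem (hDW hx) (hDW hy), ?_⟩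
        have h1 : ℓ x = 1 := hx1
        have h2 : ℓ y = 1 := hy1
        simp [h1, h2]
      · have hD0 : ∀ x ∈ D, x = 0 := fun x hx => by
          refine hD.eq_zero_of_nonpos hx (not_lt.1 fun h => hne ⟨_, hD.inv_smul_mem hx h⟩)
        have hsub : (D : Set V).Subsingleton := fun x hx y hy => (hD0 x hx).trans (hD0 y hy).symm
        have : fwdDiff b (fun t : ℝ≥0 => φ (t • D)) = 0 := by
          ext t
          simp [fwdDiff, htrans.smul_eq_of_subsingleton hsub]
        rw [this, foldr_fwdDiff_zero, Pi.zero_apply]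
    obtain ⟨x₀, hx₀⟩ := X.nonempty
    set Y := X.translate (-x₀) with hY
    have hYmem : ∀ y, y ∈ Y ↔ ∃ x ∈ X, -x₀ + x = y := fun y => Iff.rfl
    have hY0 : 0 ∈ Y := (hYmem 0).2 ⟨x₀, hx₀, by simp⟩
    have hYW : (Y : Set V) ⊆ W := by
      intro y hy
      obtain ⟨x, hx, rfl⟩ := (hYmem y).1 hy
      rw [neg_add_eq_sub]
      exact hX x hx x₀ hx₀
    have hYX : Ψ Y = Ψ X := by
      simp only [hΨ, hY, smul_translate, htrans (_ • -x₀)]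
    change Ψ X = 0
    rw [← hYX]
    refine (isClosed_singleton.preimage hΨcont).closure_subset
      (Metric.mem_closure_iff.2 fun ε hε => ?_ : Y ∈ closure (Ψ ⁻¹' {0}))
    obtain ⟨s, P, hP, hdist⟩ := exists_polytope_dist_le hY0 hYW (half_pos hε)
    have hP' : ∀ x, x ∈ P ↔ x ∈ W ∧ ∀ ℓ ∈ s, ℓ x ≤ 1 := fun x => by
      rw [← SetLike.mem_coe, hP]; rfl
    -- `P` truncates the cone `W`; the functional `0` adds a vacuous constraint, making the list
    -- nonempty.
    refine ⟨P, hΨval.eq_zero_of_isConeTruncation hlow hpyr s 0 P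
      (fun x hx => ((hP' x).1 hx).1) ⟨?_, ?_, ?_⟩, hdist.trans_lt (half_lt_self hε)⟩
    · exact (hP' 0).2 ⟨W.zero_mem, by simp⟩
    · intro x hx m hm
      rcases List.mem_cons.1 hm with rfl | hm
      · simp
      · exact ((hP' x).1 hx).2 m hm
    · intro x hx t _ h
      exact (hP' _).2 ⟨W.smul_mem t ((hP' x).1 hx).1, fun m hm => h m (List.mem_cons_of_mem _ hm)⟩

end Polynomiality

end ConvexBody

theorem mainTheorem3 {V : Type*} [NormedAddCommGroup V] [NormedSpace ℝ V] [FiniteDimensional ℝ V]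
    {A : Type*} [AddCommGroup A] [TopologicalSpace A] [IsTopologicalAddGroup A] [T2Space A]
    (φ : ConvexBody V → A) (hcont : Continuous φ) (hval : ConvexBody.IsValuation φ)
    (htrans : ConvexBody.IsTranslationInvariant φ) (d : ℕ) (X : ConvexBody V) (hX : X.dim = d)
    (b : Fin (d + 1) → ℝ≥0) :
    iteratedDifference b (fun t : ℝ≥0 => φ (t • X)) = 0 := by

  refine ConvexBody.foldr_fwdDiff_smul_eq_zero hcont hval htrans (List.ofFn b)
    (affineSpan ℝ (X : Set V)).direction ?_ X fun x hx y hy => ?_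
  · rw [List.length_ofFn]
    exact Nat.lt_succ_of_le hX.le
  · exact AffineSubspace.vsub_mem_direction (subset_affineSpan ℝ _ hx) (subset_affineSpan ℝ _ hy)
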